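/- Let $S$ and $A$ be finite sets, $A\neq\emptyset$, let $p(s,a,\cdot)$ be a probability distribution on $S$ for every $(s,a)\in S\times A$, let $R:S\times A\times S\to\mathbb R$, and let $0<\beta<1$. For $Q:S\times A\to\mathbb R$ define $$HQ(s,a)=\sum_{s'\in S}p(s,a,s')\Bigl(R(s,a,s')+\beta\max_{a'\in A}Q(s',a')\Bigr).$$ On a probability space with a filtration $(\mathcal F_t)_{t\ge 0}$, consider asynchronous tabular Q-learning: in period $t$ a pair $(s_t,a_t)\in S\times A$, chosen as an $\mathcal F_t$-measurable random variable (by any, possibly randomized, exploration policy), is updated, using a next state $s'_t$ that is $\mathcal F_{t+1}$-measurable and satisfies $\mathbb P(s'_t=x\mid\mathcal F_t)=p(s_t,a_t,x)$ for all $x\in S$ (for a single trajectory, $s_{t+1}=s'_t$, but this is not required). The step sizes $\gamma_t(s,a)\ge 0$ are $\mathcal F_t$-measurable random variables with $\gamma_t(s,a)=0$ whenever $(s,a)\ne(s_t,a_t)$. Starting from an $\mathcal F_0$-measurable (for example deterministic) table $Q_0:S\times A\to\mathbb R$, the iterates are $$Q_{t+1}(s,a)=(1-\gamma_t(s,a))\,Q_t(s,a)+\gamma_t(s,a)\Bigl(R(s,a,s'_t)+\beta\max_{\tilde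 a\in A}Q_t(s'_t,\tilde a)\Bigr),\qquad (s,a)\in S\times A.$$ Suppose that with probability $1$, for every $(s,a)\in S\times A$, $$\sum_{t=0}^{\infty}\gamma_t(s,a)=\infty\quad\text{and}\quad\sum_{t=0}^{\infty}\gamma_t(s,a)^2<\infty .$$ Then $H$ is a $\beta$-contraction for the maximum metric on $\mathbb R^{S\times A}$, it has a unique fixed point $Q^*$, and $Q_t$ converges to $Q^*$ with probability $1$. -/

import Mathlib

open MeasureTheory Filter Topology

/-- A discounted dynamic programming model with finite state space `S`, finite action set `A`
(every action is feasible in every state), transition probabilities `p s a s'`,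
payoffs `R s a s'` and discount factor `β ∈ (0, 1)`. -/
structure FiniteMDP (S A : Type*) [Fintype S] where
  p : S → A → S → ℝ
  p_nonneg : ∀ s a s', 0 ≤ p s a s'
  p_sum : ∀ s a, ∑ s', p s a s' = 1
  R : S → A → S → ℝ
  β : ℝ
  β_pos : 0 < β
  β_lt_one : β < 1

namespace FiniteMDP

variable {S A : Type*} [Fintype S] [Fintype A] [Nonempty A]

/-- The greedy value `max_{a'} Q(s, a')`. -/
noncomputable def greedy (Q : S → A → ℝ) (s : S) : ℝ :=
  Finset.univ.sup' Finset.univ_nonempty (fun a' : A => Q s a')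

/-- The operator
`(H Q)(s, a) = ∑_{s'} p(s, a, s') (R(s, a, s') + β max_{a'} Q(s', a'))`. -/
noncomputable def H (M : FiniteMDP S A) (Q : S → A → ℝ) : S → A → ℝ :=
  fun s a => ∑ s', M.p s a s' * (M.R s a s' + M.β * greedy Q s')

/-- The tabular Q-learning recursion along one realization: initial table `Q₀`, step sizes
`γ t s a`, and `next t` the state sampled at period `t`. -/
noncomputable def qLearning (M : FiniteMDP S A) (Q₀ : S → A → ℝ) (γ : ℕ → S → A → ℝ)
    (next : ℕ → S) : ℕ → S → A → ℝ
  | 0 => Q₀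
  | t + 1 => fun s a =>
      (1 - γ t s a) * M.qLearning Q₀ γ next t s a +
        γ t s a * (M.R s a (next t) + M.β * greedy (M.qLearning Q₀ γ next t) (next t))

end FiniteMDP

/-- The random data that drive asynchronous Q-learning. `ℱ t` is the information available
when the update of period `t` is made, before its transition is sampled. In period `t` only the
pair `(st t, act t)` is updated: `st t`, `act t` and the step sizes `γ t` are functions of the
history `ℱ t` (the actions come from an arbitrary exploration policy, possibly randomized),
and the next state `next t` has conditional law `p (st t) (act t) ·` given `ℱ t`.
A single trajectory is the case `st (t + 1) = next t`; restarts at a new state are allowed. -/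
structure IsQLearningData {S A Ω : Type*} [Fintype S] [MeasurableSpace S] [MeasurableSpace A]
    {mΩ : MeasurableSpace Ω} (M : FiniteMDP S A) (μ : Measure Ω) (ℱ : Filtration ℕ mΩ)
    (Q₀ : Ω → S → A → ℝ) (st : ℕ → Ω → S) (act : ℕ → Ω → A) (next : ℕ → Ω → S)
    (γ : ℕ → Ω → S → A → ℝ) : Prop where
  measurable_init : ∀ s a, Measurable[ℱ 0] (fun ω => Q₀ ω s a)
  measurable_st : ∀ t, Measurable[ℱ t] (st t)
  measurable_act : ∀ t, Measurable[ℱ t] (act t)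
  measurable_next : ∀ t, Measurable[ℱ (t + 1)] (next t)
  measurable_step : ∀ t s a, Measurable[ℱ t] (fun ω => γ t ω s a)
  step_nonneg : ∀ t ω s a, 0 ≤ γ t ω s a
  step_eq_zero : ∀ t ω s a, (s, a) ≠ (st t ω, act t ω) → γ t ω s a = 0
  condLaw_next : ∀ t s',
    μ[Set.indicator {ω | next t ω = s'} (fun _ => (1 : ℝ)) | ℱ t]
      =ᵐ[μ] fun ω => M.p (st t ω) (act t ω) s'

/-! Each update of a coordinate is an averaging step towards `M.H Q` plus noise of conditional mean
zero; a coordinate not selected has step size zero and obeys the same formula, so asynchrony needs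
no separate treatment. Almost surely the accumulated noise converges, and the rest is deterministic.

Noise: its factor `target` is bounded only path by path, so it is expanded over the possible next
states `x` as a predictable coefficient times a centred indicator of size at most one. Rewards are
bounded and `β < 1`, so iterates are bounded on every path with square-summable steps, without using
cancellation (`exists_qLearning_norm_le`); the coefficients are then square-summable. Truncating
them gives martingales bounded in L², which converge (`ae_tendsto_sum_mul_of_summable_sq`).

Path: if the error is eventually at most `D`, the contraction property puts the averaging target
within `β * D` of the fixed point. Divergent step sums forget the past
(`eventually_abs_le_of_relaxation`), so the error is eventually at most `β * D + ε`. Iteration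
drives it to zero. -/

/-! ### Convergence of martingale transforms -/

section MartingaleTransform

variable {Ω : Type*} {mΩ : MeasurableSpace Ω} {μ : Measure Ω} {ℱ : Filtration ℕ mΩ}

/-- The process `b` switched off as soon as its sum of squares exceeds `K`. -/
noncomputable def sqTruncate (b : ℕ → Ω → ℝ) (K : ℝ) (t : ℕ) (ω : Ω) : ℝ :=
  if ∑ k ∈ Finset.range (t + 1), b k ω ^ 2 ≤ K then b t ω else 0

lemma sqTruncate_sq_le (b : ℕ → Ω → ℝ) (K : ℝ) (t : ℕ) (ω : Ω) :
    sqTruncate b K t ω ^ 2 ≤ b t ω ^ 2 := by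
  unfold sqTruncate
  split_ifs
  · exact le_rfl
  · simpa using sq_nonneg (b t ω)

/-- Partial sums of squares are monotone: until they pass `K` they dominate the truncated sum, and
afterwards every new truncated term is zero. -/
lemma sum_sqTruncate_sq_le (b : ℕ → Ω → ℝ) {K : ℝ} (hK : 0 ≤ K) (n : ℕ) (ω : Ω) :
    ∑ t ∈ Finset.range n, sqTruncate b K t ω ^ 2 ≤ K := by
  induction n with
  | zero => simpa using hK
  | succ n ih =>
    by_cases h : ∑ k ∈ Finset.range (n + 1), b k ω ^ 2 ≤ K
    · exact (Finset.sum_le_sum fun t _ => sqTruncate_sq_le b K t ω).trans h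
    · rw [Finset.sum_range_succ]
      simpa [sqTruncate, h] using ih

lemma abs_sqTruncate_le (b : ℕ → Ω → ℝ) {K : ℝ} (hK : 0 ≤ K) (t : ℕ) (ω : Ω) :
    |sqTruncate b K t ω| ≤ √K := by
  apply Real.abs_le_sqrt
  refine le_trans ?_ (sum_sqTruncate_sq_le b hK (t + 1) ω)
  exact Finset.single_le_sum (f := fun t => sqTruncate b K t ω ^ 2)
    (fun i _ => sq_nonneg _) (Finset.self_mem_range_succ t)

lemma measurable_sqTruncate {b : ℕ → Ω → ℝ} (hb : ∀ t, Measurable[ℱ t] (b t)) (K : ℝ) (t : ℕ) :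
    Measurable[ℱ t] (sqTruncate b K t) := by
  refine Measurable.ite (measurableSet_le ?_ measurable_const) (hb t) measurable_const
  refine Finset.measurable_fun_sum _ fun k hk => ?_
  exact ((hb k).mono (ℱ.mono (Nat.lt_succ_iff.mp (Finset.mem_range.mp hk))) le_rfl).pow_const 2

variable [IsProbabilityMeasure μ]

/-- A martingale transform by a predictable process whose squares have a deterministically
bounded sum converges almost surely. -/
lemma ae_tendsto_sum_mul_of_sum_sq_le {c ξ : ℕ → Ω → ℝ} {K : ℝ}
    (hc : ∀ t, Measurable[ℱ t] (c t)) (hξ : ∀ t, Measurable[ℱ (t + 1)] (ξ t))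
    (hξ1 : ∀ t ω, |ξ t ω| ≤ 1) (hξ0 : ∀ t, μ[ξ t | ℱ t] =ᵐ[μ] 0)
    (hcb : ∀ t ω, |c t ω| ≤ √K) (hcK : ∀ n ω, ∑ t ∈ Finset.range n, c t ω ^ 2 ≤ K) :
    ∀ᵐ ω ∂μ, ∃ l, Tendsto (fun n => ∑ t ∈ Finset.range n, c t ω * ξ t ω) atTop (𝓝 l) := by
  set X : ℕ → Ω → ℝ := fun n ω => ∑ t ∈ Finset.range n, c t ω * ξ t ω with hX
  have hXsucc : ∀ n, X (n + 1) = X n + c n * ξ n := fun n => by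
    ext ω; simp [hX, Finset.sum_range_succ]
  have hXm : ∀ n, Measurable[ℱ n] (X n) := fun n => by
    refine Finset.measurable_fun_sum _ fun k hk => ?_
    have hk' := Finset.mem_range.mp hk
    exact ((hc k).mono (ℱ.mono hk'.le) le_rfl).mul ((hξ k).mono (ℱ.mono hk') le_rfl)
  have hcm : ∀ t, Measurable (c t) := fun t => (hc t).mono (ℱ.le t) le_rfl
  have hξm : ∀ t, Measurable (ξ t) := fun t => (hξ t).mono (ℱ.le _) le_rfl
  have hXm' : ∀ t, Measurable (X t) := fun t => (hXm t).mono (ℱ.le t) le_rfl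
  have hcξ : ∀ t ω, |c t ω * ξ t ω| ≤ √K := fun t ω => by
    rw [abs_mul]
    exact (mul_le_of_le_one_right (abs_nonneg _) (hξ1 t ω)).trans (hcb t ω)
  have hXb : ∀ n ω, |X n ω| ≤ n * √K := fun n ω => by
    refine (Finset.abs_sum_le_sum_abs _ _).trans ?_
    refine (Finset.sum_le_sum fun t _ => hcξ t ω).trans ?_
    simp
  have hint : ∀ {f : Ω → ℝ} (B : ℝ), Measurable f → (∀ ω, |f ω| ≤ B) → Integrable f μ :=
    fun B hf hB => Integrable.of_bound hf.aestronglyMeasurable B (Eventually.of_forall hB)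
  have hξi : ∀ t, Integrable (ξ t) μ := fun t => hint 1 (hξm t) (hξ1 t)
  have hXi : ∀ n, Integrable (X n) μ := fun n => hint _ (hXm' n) (hXb n)
  have hpull : ∀ t {f : Ω → ℝ} (B : ℝ), Measurable[ℱ t] f → (∀ ω, |f ω| ≤ B) →
      μ[f * ξ t | ℱ t] =ᵐ[μ] 0 := fun t f B hf hB => by
    filter_upwards [condExp_stronglyMeasurable_mul_of_bound (ℱ.le t) hf.stronglyMeasurable
      (hξi t) B (Eventually.of_forall hB), hξ0 t] with ω h1 h2
    simp [h1, h2]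
  have hmart : Martingale X ℱ μ := by
    refine martingale_of_condExp_sub_eq_zero_nat (fun n => (hXm n).stronglyMeasurable) hXi
      fun n => ?_
    rw [hXsucc, add_sub_cancel_left]
    exact hpull n _ (hc n) (hcb n)
  have hsq : ∀ n, ∫ ω, X n ω ^ 2 ∂μ ≤ ∫ ω, ∑ t ∈ Finset.range n, c t ω ^ 2 ∂μ := fun n => by
    have hci : ∀ t, Integrable (fun ω => c t ω ^ 2) μ := fun t =>
      hint (√K ^ 2) ((hcm t).pow_const 2) fun ω => by
        rw [abs_pow]; exact pow_le_pow_left₀ (abs_nonneg _) (hcb t ω) 2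
    have hXi2 : ∀ n, Integrable (fun ω => X n ω ^ 2) μ := fun n =>
      hint ((n * √K) ^ 2) ((hXm' n).pow_const 2) fun ω => by
        rw [abs_pow]; exact pow_le_pow_left₀ (abs_nonneg _) (hXb n ω) 2
    induction n with
    | zero => simp [hX]
    | succ n ih =>
      have hXcb : ∀ ω, |(X n * c n) ω| ≤ n * √K * √K := fun ω => by
        rw [Pi.mul_apply, abs_mul]
        exact mul_le_mul (hXb n ω) (hcb n ω) (abs_nonneg _) (by positivity)
      -- The factor `X n * c n` is known at time `n` and bounded, so conditioning on `ℱ n` kills the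
      -- cross term.
      have hcross : ∫ ω, (X n * c n * ξ n) ω ∂μ = 0 := by
        rw [← integral_condExp (ℱ.le n), integral_congr_ae
          (hpull n _ ((hXm n).mul (hc n)) hXcb)]
        simp
      have hcri : Integrable (X n * c n * ξ n) μ :=
        hint (n * √K * √K) (((hXm' n).mul (hcm n)).mul (hξm n)) fun ω => by
          rw [Pi.mul_apply, abs_mul]
          exact (mul_le_of_le_one_right (abs_nonneg _) (hξ1 n ω)).trans (hXcb ω)
      have hle : ∀ ω, X (n + 1) ω ^ 2 ≤ X n ω ^ 2 + 2 * (X n * c n * ξ n) ω + c n ω ^ 2 := by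
        intro ω
        have h1 : ξ n ω ^ 2 ≤ 1 := (sq_le_one_iff_abs_le_one _).mpr (hξ1 n ω)
        have h2 := mul_le_mul_of_nonneg_left h1 (sq_nonneg (c n ω))
        simp only [hXsucc, Pi.add_apply, Pi.mul_apply]
        linarith
      simp_rw [Finset.sum_range_succ]
      rw [integral_add (integrable_finsetSum _ fun t _ => hci t) (hci n)]
      refine (integral_mono (hXi2 (n + 1))
        (((hXi2 n).add (hcri.const_mul 2)).add (hci n)) hle).trans ?_
      have e : ∫ ω, ((X n ω ^ 2 + 2 * (X n * c n * ξ n) ω) + c n ω ^ 2) ∂μ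
          = ∫ ω, X n ω ^ 2 ∂μ + 2 * ∫ ω, (X n * c n * ξ n) ω ∂μ + ∫ ω, c n ω ^ 2 ∂μ := by
        have h1 : Integrable (fun ω => 2 * (X n * c n * ξ n) ω) μ := hcri.const_mul 2
        have h2 : Integrable (fun ω => X n ω ^ 2 + 2 * (X n * c n * ξ n) ω) μ := (hXi2 n).add h1
        rw [integral_add h2 (hci n), integral_add (hXi2 n) h1, integral_const_mul]
      refine (le_of_eq e).trans ?_
      rw [hcross]
      linarith
  -- Since `|x| ≤ 1 + x ^ 2`, the second-moment bound `K` gives the L¹ bound required by the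
  -- convergence theorem.
  have hL1 : ∀ n, eLpNorm (X n) 1 μ ≤ ((1 + K).toNNReal : ENNReal) := fun n => by
    rw [eLpNorm_one_eq_lintegral_enorm, ← ofReal_integral_norm_eq_lintegral_enorm (hXi n)]
    refine ENNReal.ofReal_le_ofReal ?_
    have hXi2 : Integrable (fun ω => X n ω ^ 2) μ :=
      hint ((n * √K) ^ 2) ((hXm' n).pow_const 2) fun ω => by
        rw [abs_pow]; exact pow_le_pow_left₀ (abs_nonneg _) (hXb n ω) 2
    have h1 : ∫ ω, ‖X n ω‖ ∂μ ≤ ∫ ω, (1 + X n ω ^ 2) ∂μ := by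
      refine integral_mono (hXi n).norm ((integrable_const 1).add hXi2) fun ω => ?_
      simp only [Real.norm_eq_abs]
      nlinarith [sq_abs (X n ω), sq_nonneg (|X n ω| - 1)]
    have h2 : ∫ ω, (1 + X n ω ^ 2) ∂μ = 1 + ∫ ω, X n ω ^ 2 ∂μ := by
      rw [integral_add (integrable_const 1) hXi2]; simp
    have h3 : ∫ ω, ∑ t ∈ Finset.range n, c t ω ^ 2 ∂μ ≤ ∫ _, K ∂μ := by
      refine integral_mono_of_nonneg
        (Eventually.of_forall fun ω => Finset.sum_nonneg fun t _ => sq_nonneg _)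
        (integrable_const K) (Eventually.of_forall (hcK n))
    simp only [integral_const, probReal_univ, one_smul] at h3
    linarith [hsq n]
  exact hmart.submartingale.exists_ae_tendsto_of_bdd hL1

/-- A martingale transform by an adapted square-summable process converges almost surely. -/
lemma ae_tendsto_sum_mul_of_summable_sq {b ξ : ℕ → Ω → ℝ}
    (hb : ∀ t, Measurable[ℱ t] (b t)) (hξ : ∀ t, Measurable[ℱ (t + 1)] (ξ t))
    (hξ1 : ∀ t ω, |ξ t ω| ≤ 1) (hξ0 : ∀ t, μ[ξ t | ℱ t] =ᵐ[μ] 0)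
    (hsq : ∀ᵐ ω ∂μ, Summable fun t => b t ω ^ 2) :
    ∀ᵐ ω ∂μ, ∃ l, Tendsto (fun n => ∑ t ∈ Finset.range n, b t ω * ξ t ω) atTop (𝓝 l) := by
  have h : ∀ᵐ ω ∂μ, ∀ K : ℕ, ∃ l, Tendsto
      (fun n => ∑ t ∈ Finset.range n, sqTruncate b K t ω * ξ t ω) atTop (𝓝 l) :=
    ae_all_iff.mpr fun K => ae_tendsto_sum_mul_of_sum_sq_le (K := K)
      (measurable_sqTruncate hb K) hξ hξ1 hξ0
      (abs_sqTruncate_le b K.cast_nonneg) (sum_sqTruncate_sq_le b K.cast_nonneg)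
  filter_upwards [h, hsq] with ω hω hs
  -- On this path, a level above the total sum of squares makes truncation inactive. Integer levels
  -- keep the exceptional sets countable in number.
  obtain ⟨K, hK⟩ := exists_nat_ge (∑' t, b t ω ^ 2)
  have hbK : ∀ t, sqTruncate b K t ω = b t ω := fun t =>
    if_pos ((hs.sum_le_tsum _ fun i _ => sq_nonneg _).trans hK)
  simpa only [hbK] using hω K

end MartingaleTransform

/-! ### Scalar relaxation with divergent steps -/

/-- A scalar recursion with divergent step sizes contracts to the size of its forcing term. -/
lemma eventually_abs_le_of_relaxation {u g : ℕ → ℝ} {c ε : ℝ} (hε : 0 < ε)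
    (hg1 : ∀ᶠ t in atTop, g t ≤ 1)
    (hsum : Tendsto (fun n => ∑ t ∈ Finset.range n, g t) atTop atTop)
    (hu : ∀ᶠ t in atTop, |u (t + 1)| ≤ (1 - g t) * |u t| + g t * c) :
    ∀ᶠ t in atTop, |u t| ≤ c + ε := by
  obtain ⟨N, hN⟩ := eventually_atTop.mp (hg1.and hu)
  set G : ℕ → ℝ := fun n => ∑ t ∈ Finset.range n, g t with hG
  -- The maximum with `0` keeps the bound nonnegative, so that `1 - g ≤ exp (-g)` may be multiplied
  -- into it.
  set C := max (|u N| - c) 0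
  have key : ∀ n, N ≤ n → |u n| - c ≤ C * Real.exp (G N - G n) := by
    intro n hn
    induction n, hn using Nat.le_induction with
    | base => simp [C]
    | succ n hn ih =>
      obtain ⟨h1, h2⟩ := hN n hn
      have e : G N - G (n + 1) = (G N - G n) + -g n := by
        simp only [hG, Finset.sum_range_succ]; ring
      rw [e, Real.exp_add, ← mul_assoc]
      have h3 : |u (n + 1)| - c ≤ (1 - g n) * (|u n| - c) := by linarith
      have hC : 0 ≤ C * Real.exp (G N - G n) :=
        mul_nonneg (le_max_right _ _) (Real.exp_nonneg _)
      calc |u (n + 1)| - c ≤ (1 - g n) * (C * Real.exp (G N - G n)) :=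
            h3.trans (mul_le_mul_of_nonneg_left ih (by linarith))
        _ ≤ Real.exp (-g n) * (C * Real.exp (G N - G n)) :=
            mul_le_mul_of_nonneg_right (by linarith [Real.add_one_le_exp (-g n)]) hC
        _ = _ := mul_comm _ _
  have hlim : Tendsto (fun n => C * Real.exp (G N - G n)) atTop (𝓝 0) := by
    have : Tendsto (fun n => G N - G n) atTop atBot := by
      simpa only [sub_eq_add_neg, Function.comp_def] using
        tendsto_atBot_add_const_left _ (G N) (tendsto_neg_atTop_atBot.comp hsum)
    simpa using (Real.tendsto_exp_atBot.comp this).const_mul C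
  filter_upwards [hlim.eventually_le_const hε, eventually_ge_atTop N] with n h1 h2
  linarith [key n h2]

/-! ### The Bellman operator as a contraction -/

namespace FiniteMDP

variable {S A : Type*} [Fintype S] [Fintype A] [Nonempty A]

omit [Nonempty A] in
lemma abs_apply_le_norm (Q : S → A → ℝ) (s : S) (a : A) : |Q s a| ≤ ‖Q‖ :=
  (norm_le_pi_norm (Q s) a).trans (norm_le_pi_norm Q s)

omit [Nonempty A] in
lemma norm_le_of_forall_abs_le {Q : S → A → ℝ} {B : ℝ} (hB : 0 ≤ B)
    (h : ∀ s a, |Q s a| ≤ B) : ‖Q‖ ≤ B :=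
  (pi_norm_le_iff_of_nonneg hB).mpr fun s => (pi_norm_le_iff_of_nonneg hB).mpr (h s)

lemma greedy_le_greedy_add (Q W : S → A → ℝ) (s : S) : greedy Q s ≤ greedy W s + ‖Q - W‖ := by
  refine Finset.sup'_le _ _ fun a _ => ?_
  have h1 : W s a ≤ greedy W s := Finset.le_sup' (fun a => W s a) (Finset.mem_univ a)
  have h2 := (le_abs_self _).trans (abs_apply_le_norm (Q - W) s a)
  simp only [Pi.sub_apply] at h2
  linarith

lemma abs_greedy_sub_le (Q W : S → A → ℝ) (s : S) : |greedy Q s - greedy W s| ≤ ‖Q - W‖ := by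
  have h1 := greedy_le_greedy_add Q W s
  have h2 := greedy_le_greedy_add W Q s
  rw [norm_sub_rev] at h2
  rw [abs_sub_le_iff]
  constructor <;> linarith

lemma abs_greedy_le (Q : S → A → ℝ) (s : S) : |greedy Q s| ≤ ‖Q‖ := by
  have h := abs_greedy_sub_le Q 0 s
  have h0 : greedy (0 : S → A → ℝ) s = 0 := by simp [greedy]
  simpa [h0] using h

lemma abs_H_sub_le (M : FiniteMDP S A) (Q W : S → A → ℝ) (s : S) (a : A) :
    |M.H Q s a - M.H W s a| ≤ M.β * ‖Q - W‖ := by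
  have e : M.H Q s a - M.H W s a
      = ∑ s', M.p s a s' * (M.β * (greedy Q s' - greedy W s')) := by
    simp only [H, ← Finset.sum_sub_distrib]
    exact Finset.sum_congr rfl fun s' _ => by ring
  rw [e]
  calc _ ≤ ∑ s', |M.p s a s' * (M.β * (greedy Q s' - greedy W s'))| :=
        Finset.abs_sum_le_sum_abs _ _
    _ ≤ ∑ s', M.p s a s' * (M.β * ‖Q - W‖) := by
        refine Finset.sum_le_sum fun s' _ => ?_
        rw [abs_mul, abs_mul, abs_of_nonneg (M.p_nonneg s a s'), abs_of_pos M.β_pos]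
        exact mul_le_mul_of_nonneg_left
          (mul_le_mul_of_nonneg_left (abs_greedy_sub_le Q W s') M.β_pos.le) (M.p_nonneg s a s')
    _ = M.β * ‖Q - W‖ := by rw [← Finset.sum_mul, M.p_sum, one_mul]

lemma dist_H_le (M : FiniteMDP S A) (Q W : S → A → ℝ) :
    dist (M.H Q) (M.H W) ≤ M.β * dist Q W := by
  rw [dist_eq_norm, dist_eq_norm]
  exact norm_le_of_forall_abs_le (mul_nonneg M.β_pos.le (norm_nonneg _)) (M.abs_H_sub_le Q W)

lemma contractingWith_H (M : FiniteMDP S A) :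
    ContractingWith ⟨M.β, M.β_pos.le⟩ (M.H) :=
  ⟨by exact_mod_cast M.β_lt_one, LipschitzWith.of_dist_le_mul M.dist_H_le⟩

/-- The one-sample target `R(s, a, s') + β max_{a'} Q(s', a')`. -/
noncomputable def target (M : FiniteMDP S A) (Q : S → A → ℝ) (s : S) (a : A) (s' : S) : ℝ :=
  M.R s a s' + M.β * greedy Q s'

lemma H_eq_sum_target (M : FiniteMDP S A) (Q : S → A → ℝ) (s : S) (a : A) :
    M.H Q s a = ∑ s', M.p s a s' * M.target Q s a s' := rfl

lemma abs_target_le (M : FiniteMDP S A) (Q : S → A → ℝ) (s : S) (a : A) (s' : S) :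
    |M.target Q s a s'| ≤ ‖M.R‖ + M.β * ‖Q‖ := by
  refine (abs_add_le _ _).trans (add_le_add ?_ ?_)
  · exact (norm_le_pi_norm (M.R s a) s').trans
      ((norm_le_pi_norm (M.R s) a).trans (norm_le_pi_norm M.R s))
  · rw [abs_mul, abs_of_pos M.β_pos]
    exact mul_le_mul_of_nonneg_left (abs_greedy_le Q s') M.β_pos.le

lemma qLearning_succ (M : FiniteMDP S A) (Q₀ : S → A → ℝ) (γ : ℕ → S → A → ℝ) (next : ℕ → S)
    (t : ℕ) (s : S) (a : A) :
    M.qLearning Q₀ γ next (t + 1) s a = (1 - γ t s a) * M.qLearning Q₀ γ next t s a +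
      γ t s a * M.target (M.qLearning Q₀ γ next t) s a (next t) := rfl

/-! ### Pathwise boundedness and convergence -/

section Pathwise

variable (M : FiniteMDP S A) (Q₀ : S → A → ℝ) {γ : ℕ → S → A → ℝ} (next : ℕ → S)

omit [Nonempty A] in
lemma eventually_step_le_one (hsq : ∀ s a, Summable fun t => γ t s a ^ 2) :
    ∀ᶠ t in atTop, ∀ s a, γ t s a ≤ 1 := by
  refine eventually_all.mpr fun s => eventually_all.mpr fun a => ?_
  filter_upwards [(hsq s a).tendsto_atTop_zero.eventually_le_const one_pos] with t ht
  exact (abs_le_one_iff_mul_self_le_one.mpr (by rwa [← sq])) |> (le_abs_self _).trans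

/-- Once all steps are at most one, updates are convex combinations, and a ball whose radius
satisfies `‖M.R‖ + M.β * B ≤ B` is invariant whatever states are sampled. Only finitely many earlier
iterates remain. -/
lemma exists_qLearning_norm_le (hγ : ∀ t s a, 0 ≤ γ t s a)
    (hsq : ∀ s a, Summable fun t => γ t s a ^ 2) :
    ∃ B, ∀ t, ‖M.qLearning Q₀ γ next t‖ ≤ B := by
  set Q := M.qLearning Q₀ γ next with hQ
  obtain ⟨N, hN⟩ := eventually_atTop.mp (eventually_step_le_one hsq)
  have hβ : 0 < 1 - M.β := by linarith [M.β_lt_one]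
  set B := max ‖Q N‖ (‖M.R‖ / (1 - M.β)) with hB
  have hB0 : 0 ≤ B := (norm_nonneg _).trans (le_max_left _ _)
  have hRB : ‖M.R‖ + M.β * B ≤ B := by
    have h := (div_le_iff₀ hβ).mp (le_max_right ‖Q N‖ (‖M.R‖ / (1 - M.β)))
    rw [← hB] at h
    linarith
  have key : ∀ t, N ≤ t → ‖Q t‖ ≤ B := by
    intro t ht
    induction t, ht using Nat.le_induction with
    | base => exact le_max_left _ _
    | succ t ht ih =>
      refine norm_le_of_forall_abs_le hB0 fun s a => ?_
      have h1 := hN t ht s a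
      have h2 : |M.target (Q t) s a (next t)| ≤ B :=
        (M.abs_target_le (Q t) s a (next t)).trans
          ((add_le_add_right (mul_le_mul_of_nonneg_left ih M.β_pos.le) _).trans hRB)
      rw [hQ, qLearning_succ, ← hQ]
      refine (abs_add_le _ _).trans ?_
      rw [abs_mul, abs_mul, abs_of_nonneg (hγ t s a), abs_of_nonneg (sub_nonneg.mpr h1)]
      have h3 := mul_le_mul_of_nonneg_left ((abs_apply_le_norm (Q t) s a).trans ih)
        (sub_nonneg.mpr h1)
      have h4 := mul_le_mul_of_nonneg_left h2 (hγ t s a)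
      linarith
  refine ⟨B + ∑ t ∈ Finset.range N, ‖Q t‖, fun t => ?_⟩
  have hs : 0 ≤ ∑ t ∈ Finset.range N, ‖Q t‖ := Finset.sum_nonneg fun _ _ => norm_nonneg _
  rcases le_or_gt N t with h | h
  · linarith [key t h]
  · have := Finset.single_le_sum (f := fun t => ‖Q t‖) (fun _ _ => norm_nonneg _)
      (Finset.mem_range.mpr h)
    linarith

/-- Pathwise convergence of Q-learning, given convergence of the accumulated noise. -/
lemma tendsto_qLearning {Qstar : S → A → ℝ} (hfix : M.H Qstar = Qstar)
    (hγ : ∀ t s a, 0 ≤ γ t s a)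
    (hsum : ∀ s a, Tendsto (fun n => ∑ t ∈ Finset.range n, γ t s a) atTop atTop)
    (hsq : ∀ s a, Summable fun t => γ t s a ^ 2)
    (hnoise : ∀ s a, ∃ l, Tendsto (fun n => ∑ t ∈ Finset.range n,
      γ t s a * (M.target (M.qLearning Q₀ γ next t) s a (next t) -
        M.H (M.qLearning Q₀ γ next t) s a)) atTop (𝓝 l)) :
    Tendsto (M.qLearning Q₀ γ next) atTop (𝓝 Qstar) := by
  obtain ⟨B, hB⟩ := M.exists_qLearning_norm_le Q₀ next hγ hsq
  set Q := M.qLearning Q₀ γ next with hQ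
  have hγ1 := eventually_step_le_one hsq
  have hstep : ∀ D ε : ℝ, 0 < ε → (∀ᶠ t in atTop, ‖Q t - Qstar‖ ≤ D) →
      ∀ᶠ t in atTop, ‖Q t - Qstar‖ ≤ M.β * D + ε := by
    intro D ε hε hD
    have hD0 : 0 ≤ D := by
      obtain ⟨t, ht⟩ := hD.exists
      exact (norm_nonneg _).trans ht
    suffices h : ∀ s a, ∀ᶠ t in atTop, |(Q t - Qstar) s a| ≤ M.β * D + ε by
      filter_upwards [eventually_all.mpr fun s => eventually_all.mpr (h s)] with t ht
      exact norm_le_of_forall_abs_le (add_nonneg (mul_nonneg M.β_pos.le hD0) hε.le) ht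
    intro s a
    obtain ⟨l, hl⟩ := hnoise s a
    set P : ℕ → ℝ := fun n => ∑ t ∈ Finset.range n,
      γ t s a * (M.target (Q t) s a (next t) - M.H (Q t) s a) with hP
    have hPsucc : ∀ t, P (t + 1)
        = P t + γ t s a * (M.target (Q t) s a (next t) - M.H (Q t) s a) :=
      fun t => Finset.sum_range_succ _ _
    have hm : ∀ᶠ t in atTop, |l - P t| ≤ ε / 3 := by
      have h0 : Tendsto (fun t => |l - P t|) atTop (𝓝 0) := by
        simpa using (hl.const_sub l).abs
      exact h0.eventually_le_const (by positivity)
    -- Adding the noise tail `l - P t` to the error cancels the noise increment, leaving only the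
    -- small tail in the forcing. The three thirds of `ε` pay for the tail in the forcing, the
    -- relaxation slack, and removing the tail at the end.
    have hu := eventually_abs_le_of_relaxation (u := fun t => (Q t s a - Qstar s a) + (l - P t))
      (g := fun t => γ t s a) (c := M.β * D + ε / 3) (ε := ε / 3) (by positivity)
      (hγ1.mono fun t ht => ht s a) (hsum s a) (by
        filter_upwards [hγ1, hm, hD] with t h1 h2 h3
        have hH := (M.abs_H_sub_le (Q t) Qstar s a).trans
          (mul_le_mul_of_nonneg_left h3 M.β_pos.le)
        rw [hfix] at hH
        have e : Q (t + 1) s a - Qstar s a + (l - P (t + 1))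
            = (1 - γ t s a) * (Q t s a - Qstar s a + (l - P t))
              + γ t s a * ((M.H (Q t) s a - Qstar s a) + (l - P t)) := by
          rw [hPsucc, hQ, qLearning_succ, ← hQ]; ring
        rw [e]
        refine (abs_add_le _ _).trans ?_
        rw [abs_mul, abs_mul, abs_of_nonneg (hγ t s a),
          abs_of_nonneg (sub_nonneg.mpr (h1 s a))]
        exact add_le_add_right (mul_le_mul_of_nonneg_left
          ((abs_add_le _ _).trans (add_le_add hH h2)) (hγ t s a)) _)
    filter_upwards [hu, hm] with t h1 h2
    rw [abs_le] at h1 h2 ⊢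
    simp only [Pi.sub_apply]
    constructor <;> linarith [h1.1, h1.2, h2.1, h2.2]
  set D₀ := max B 0 + ‖Qstar‖ + 1 with hD₀
  have hD₀pos : 0 < D₀ := by positivity
  -- Taking `ε = (1 - M.β) / 2 * D` turns `M.β * D + ε` into `ρ * D`; the `+ 1` in `D₀` keeps this
  -- `ε` positive.
  set ρ := (1 + M.β) / 2 with hρ
  have hρ0 : 0 < ρ := by have := M.β_pos; positivity
  have hρ1 : ρ < 1 := by have := M.β_lt_one; rw [hρ]; linarith
  have hk : ∀ k : ℕ, ∀ᶠ t in atTop, ‖Q t - Qstar‖ ≤ ρ ^ k * D₀ := by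
    intro k
    induction k with
    | zero =>
      refine Eventually.of_forall fun t => ?_
      have := norm_sub_le (Q t) Qstar
      have := hB t
      have := le_max_left B 0
      rw [pow_zero, one_mul]
      linarith
    | succ k ih =>
      have hpos : 0 < ρ ^ k * D₀ := by positivity
      have hε : 0 < (1 - M.β) / 2 * (ρ ^ k * D₀) :=
        mul_pos (by linarith [M.β_lt_one]) hpos
      filter_upwards [hstep _ _ hε ih] with t ht
      refine ht.trans (le_of_eq ?_)
      rw [pow_succ, hρ]; ring
  rw [tendsto_iff_norm_sub_tendsto_zero]
  refine Metric.tendsto_nhds.mpr fun ε hε => ?_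
  have hlim : Tendsto (fun k : ℕ => ρ ^ k * D₀) atTop (𝓝 0) := by
    simpa using (tendsto_pow_atTop_nhds_zero_of_lt_one hρ0.le hρ1).mul_const D₀
  obtain ⟨k, hk'⟩ := (hlim.eventually_lt_const hε).exists
  filter_upwards [hk k] with t ht
  rw [Real.dist_0_eq_abs, abs_of_nonneg (norm_nonneg _)]
  exact ht.trans_lt hk'

end Pathwise

/-! ### Measurability and centring of the sampling noise -/

lemma measurable_target {Ω : Type*} {m : MeasurableSpace Ω} (M : FiniteMDP S A)
    {Q : Ω → S → A → ℝ} (hQ : ∀ s a, Measurable fun ω => Q ω s a) (s : S) (a : A) (s' : S) :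
    Measurable fun ω => M.target (Q ω) s a s' := by
  have h : Measurable fun ω => greedy (Q ω) s' := by
    have := Finset.measurable_sup' (s := (Finset.univ : Finset A)) Finset.univ_nonempty
      (f := fun a ω => Q ω s' a) fun a _ => hQ s' a
    convert this using 1
    ext ω
    simp [greedy, Finset.sup'_apply]
  exact (h.const_mul _).const_add _

end FiniteMDP

namespace IsQLearningData

open FiniteMDP

variable {S A Ω : Type*} [Fintype S] [Fintype A] [Nonempty A]
  [MeasurableSpace S] [MeasurableSingletonClass S]
  [MeasurableSpace A] [MeasurableSingletonClass A]
  {mΩ : MeasurableSpace Ω} {μ : Measure Ω} {ℱ : Filtration ℕ mΩ}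
  {M : FiniteMDP S A} {Q₀ : Ω → S → A → ℝ} {st : ℕ → Ω → S} {act : ℕ → Ω → A}
  {next : ℕ → Ω → S} {γ : ℕ → Ω → S → A → ℝ}

omit [MeasurableSingletonClass A] in
lemma measurable_qLearning (hdata : IsQLearningData M μ ℱ Q₀ st act next γ) (t : ℕ) :
    ∀ s a, Measurable[ℱ t] fun ω =>
      M.qLearning (Q₀ ω) (fun k => γ k ω) (fun k => next k ω) t s a := by
  induction t with
  | zero => exact hdata.measurable_init
  | succ t ih =>
    intro s a
    have hle : ℱ t ≤ ℱ (t + 1) := ℱ.mono t.le_succ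
    have hγ := (hdata.measurable_step t s a).mono hle le_rfl
    have hT : Measurable[ℱ (t + 1)] fun ω =>
        M.target (M.qLearning (Q₀ ω) (fun k => γ k ω) (fun k => next k ω) t) s a (next t ω) := by
      have h : ∀ s', Measurable[ℱ (t + 1)] fun ω =>
          M.target (M.qLearning (Q₀ ω) (fun k => γ k ω) (fun k => next k ω) t) s a s' :=
        fun s' => M.measurable_target (fun s a => (ih s a).mono hle le_rfl) s a s'
      -- Finiteness of `S` gives joint measurability from measurability at each fixed next state.
      have h2 := @measurable_from_prod_countable_left Ω S ℝ (ℱ (t + 1)) _ _ _ _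
        (f := fun x : Ω × S => M.target
          (M.qLearning (Q₀ x.1) (fun k => γ k x.1) (fun k => next k x.1) t) s a x.2) h
      exact h2.comp (measurable_id.prodMk (hdata.measurable_next t))
    exact ((hγ.const_sub 1).mul ((ih s a).mono hle le_rfl)).add (hγ.mul hT)

/-- The centred indicator of the event that the sampled state is `x`. -/
noncomputable def centredIndicator (M : FiniteMDP S A) (st : ℕ → Ω → S) (act : ℕ → Ω → A)
    (next : ℕ → Ω → S) (x : S) (t : ℕ) (ω : Ω) : ℝ :=
  Set.indicator {ω | next t ω = x} (fun _ => (1 : ℝ)) ω - M.p (st t ω) (act t ω) x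

omit [Fintype A] [Nonempty A] [MeasurableSpace S] [MeasurableSingletonClass S]
  [MeasurableSpace A] [MeasurableSingletonClass A] mΩ in
lemma abs_centredIndicator_le (x : S) (t : ℕ) (ω : Ω) :
    |centredIndicator M st act next x t ω| ≤ 1 := by
  have h0 := M.p_nonneg (st t ω) (act t ω) x
  have h1 : M.p (st t ω) (act t ω) x ≤ 1 := by
    rw [← M.p_sum (st t ω) (act t ω)]
    exact Finset.single_le_sum (fun i _ => M.p_nonneg _ _ i) (Finset.mem_univ x)
  have h2 : 0 ≤ Set.indicator {ω | next t ω = x} (fun _ => (1 : ℝ)) ω :=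
    Set.indicator_nonneg (fun _ _ => zero_le_one) ω
  have h3 : Set.indicator {ω | next t ω = x} (fun _ => (1 : ℝ)) ω ≤ 1 :=
    Set.indicator_le_self' (fun _ _ => zero_le_one) ω
  rw [centredIndicator, abs_le]
  constructor <;> linarith

omit [Nonempty A] in
lemma measurable_transition (hdata : IsQLearningData M μ ℱ Q₀ st act next γ) (x : S) (t : ℕ) :
    Measurable[ℱ t] fun ω => M.p (st t ω) (act t ω) x := by
  have h : Measurable fun y : S × A => M.p y.1 y.2 x := measurable_of_countable _
  exact h.comp ((hdata.measurable_st t).prodMk (hdata.measurable_act t))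

omit [Fintype A] [Nonempty A] [MeasurableSingletonClass A] in
lemma measurable_indicator_next (hdata : IsQLearningData M μ ℱ Q₀ st act next γ)
    (x : S) (t : ℕ) :
    Measurable[ℱ (t + 1)] (Set.indicator {ω | next t ω = x} (fun _ => (1 : ℝ))) :=
  measurable_const.indicator (hdata.measurable_next t (measurableSet_singleton x))

omit [Nonempty A] in
lemma measurable_centredIndicator (hdata : IsQLearningData M μ ℱ Q₀ st act next γ)
    (x : S) (t : ℕ) : Measurable[ℱ (t + 1)] (centredIndicator M st act next x t) :=
  (hdata.measurable_indicator_next x t).sub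
    ((hdata.measurable_transition x t).mono (ℱ.mono t.le_succ) le_rfl)

omit [Nonempty A] in
lemma condExp_centredIndicator [IsProbabilityMeasure μ]
    (hdata : IsQLearningData M μ ℱ Q₀ st act next γ) (x : S) (t : ℕ) :
    μ[centredIndicator M st act next x t | ℱ t] =ᵐ[μ] 0 := by
  have hI : Integrable (Set.indicator {ω | next t ω = x} (fun _ => (1 : ℝ))) μ :=
    (integrable_const 1).indicator
      (ℱ.le (t + 1) _ (hdata.measurable_next t (measurableSet_singleton x)))
  have hp := hdata.measurable_transition x t
  have hpI : Integrable (fun ω => M.p (st t ω) (act t ω) x) μ := by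
    refine Integrable.of_bound (hp.mono (ℱ.le t) le_rfl).aestronglyMeasurable 1
      (Eventually.of_forall fun ω => ?_)
    rw [Real.norm_eq_abs, abs_of_nonneg (M.p_nonneg _ _ _), ← M.p_sum (st t ω) (act t ω)]
    exact Finset.single_le_sum (fun i _ => M.p_nonneg _ _ i) (Finset.mem_univ x)
  have h := condExp_sub hI hpI (ℱ t)
  rw [condExp_of_stronglyMeasurable (ℱ.le t) hp.stronglyMeasurable hpI] at h
  filter_upwards [h, hdata.condLaw_next t x] with ω h1 h2
  refine h1.trans ?_
  simp [h2]

omit [MeasurableSingletonClass S] [MeasurableSingletonClass A] in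
/-- The noise of an update is a finite sum of multiples of centred indicators. -/
lemma step_mul_noise_eq (hdata : IsQLearningData M μ ℱ Q₀ st act next γ)
    (Q : S → A → ℝ) (t : ℕ) (ω : Ω) (s : S) (a : A) :
    γ t ω s a * (M.target Q s a (next t ω) - M.H Q s a)
      = ∑ x, γ t ω s a * M.target Q s a x * centredIndicator M st act next x t ω := by
  classical
  by_cases h : (s, a) = (st t ω, act t ω)
  · obtain ⟨rfl, rfl⟩ := Prod.mk.inj h
    have e : M.target Q (st t ω) (act t ω) (next t ω)
        = ∑ x, M.target Q (st t ω) (act t ω) x *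
          Set.indicator {ω | next t ω = x} (fun _ => (1 : ℝ)) ω := by
      simp [Set.indicator_apply]
    rw [H_eq_sum_target, e, ← Finset.sum_sub_distrib, Finset.mul_sum]
    exact Finset.sum_congr rfl fun x _ => by rw [centredIndicator]; ring
  · simp [hdata.step_eq_zero t ω s a h]

end IsQLearningData

/-! ### Almost sure convergence -/

theorem mainTheorem3 {S A Ω : Type*} [Fintype S] [Fintype A] [Nonempty A]
    [MeasurableSpace S] [MeasurableSingletonClass S]
    [MeasurableSpace A] [MeasurableSingletonClass A]
    {mΩ : MeasurableSpace Ω} (μ : Measure Ω) [IsProbabilityMeasure μ] (ℱ : Filtration ℕ mΩ)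
    (M : FiniteMDP S A) (Q₀ : Ω → S → A → ℝ) (st : ℕ → Ω → S) (act : ℕ → Ω → A)
    (next : ℕ → Ω → S) (γ : ℕ → Ω → S → A → ℝ)
    (hdata : IsQLearningData M μ ℱ Q₀ st act next γ)
    (hsum : ∀ᵐ ω ∂μ, ∀ s a,
      Tendsto (fun n => ∑ t ∈ Finset.range n, γ t ω s a) atTop atTop)
    (hsq : ∀ᵐ ω ∂μ, ∀ s a, Summable (fun t => γ t ω s a ^ 2)) :
    (∀ Q W : S → A → ℝ, dist (M.H Q) (M.H W) ≤ M.β * dist Q W) ∧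
    ∃ Qstar : S → A → ℝ, M.H Qstar = Qstar ∧ (∀ Q, M.H Q = Q → Q = Qstar) ∧
      ∀ᵐ ω ∂μ, Tendsto
        (fun t => M.qLearning (Q₀ ω) (fun k => γ k ω) (fun k => next k ω) t)
        atTop (𝓝 Qstar) := by
  refine ⟨M.dist_H_le, M.contractingWith_H.fixedPoint, M.contractingWith_H.fixedPoint_isFixedPt,
    fun Q hQ => M.contractingWith_H.fixedPoint_unique hQ, ?_⟩
  have hnoise : ∀ s a x, ∀ᵐ ω ∂μ, ∃ l, Tendsto (fun n => ∑ t ∈ Finset.range n,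
      γ t ω s a * M.target (M.qLearning (Q₀ ω) (fun k => γ k ω) (fun k => next k ω) t) s a x *
        IsQLearningData.centredIndicator M st act next x t ω) atTop (𝓝 l) := by
    intro s a x
    refine ae_tendsto_sum_mul_of_summable_sq (ℱ := ℱ)
      (b := fun t ω => γ t ω s a *
        M.target (M.qLearning (Q₀ ω) (fun k => γ k ω) (fun k => next k ω) t) s a x)
      (fun t => (hdata.measurable_step t s a).mul
        (M.measurable_target (hdata.measurable_qLearning t) s a x))
      (hdata.measurable_centredIndicator x) (IsQLearningData.abs_centredIndicator_le x)
      (hdata.condExp_centredIndicator x) ?_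
    filter_upwards [hsq] with ω hω
    -- The bound may depend on `ω`: only almost sure square-summability of the coefficients is
    -- needed.
    obtain ⟨B, hB⟩ := M.exists_qLearning_norm_le (Q₀ ω) (fun k => next k ω)
      (fun t s a => hdata.step_nonneg t ω s a) hω
    refine Summable.of_nonneg_of_le (fun t => sq_nonneg _) (fun t => ?_)
      ((hω s a).mul_right ((‖M.R‖ + M.β * B) ^ 2))
    rw [mul_pow]
    refine mul_le_mul_of_nonneg_left ?_ (sq_nonneg _)
    rw [← sq_abs]
    exact pow_le_pow_left₀ (abs_nonneg _) ((M.abs_target_le _ s a x).trans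
      (add_le_add_right (mul_le_mul_of_nonneg_left (hB t) M.β_pos.le) _)) 2
  have hnoise' := ae_all_iff.mpr fun s => ae_all_iff.mpr fun a => ae_all_iff.mpr (hnoise s a)
  filter_upwards [hnoise', hsum, hsq] with ω h1 h2 h3
  refine M.tendsto_qLearning (Q₀ ω) (fun k => next k ω) M.contractingWith_H.fixedPoint_isFixedPt
    (fun t s a => hdata.step_nonneg t ω s a) h2 h3 fun s a => ?_
  choose l hl using h1 s a
  refine ⟨∑ x, l x, ?_⟩
  have h := tendsto_finsetSum Finset.univ fun x _ => hl x
  refine h.congr fun n => ?_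
  rw [Finset.sum_comm]
  exact Finset.sum_congr rfl fun t _ => (hdata.step_mul_noise_eq _ t ω s a).symm
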